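/- All topological spaces are Hausdorff and nonempty. For a space $X$, let $\mathcal{O}$ be the collection of all open covers of $X$. Let $\Omega$ be the collection of all $\omega$-covers of $X$, i.e. of all open covers $\mathcal{U}$ of $X$ such that $X\notin\mathcal{U}$ and each finite subset of $X$ is contained in some member of $\mathcal{U}$. For a positive integer $n$, let $\mathcal{O}_n$ be the collection of all open covers $\mathcal{U}$ of $X$ such that each subset of $X$ with at most $n$ elements is contained in some member of $\mathcal{U}$. A space has the Rothberger property $\mathsf{S}_1(\mathcal{O},\mathcal{O})$ if for each sequence $(\mathcal{U}_m)_{m\in\mathbb{N}}$ of open covers of it there are $U_m\in\mathcal{U}_m$ ($m\in\mathbb{N}$) such that $\{U_m : m\in\mathbb{N}\}$ is an open cover of it. For a set $S$, let $[S]^2$ be the set of all two-element subsets of $S$. For a positive integer $k$, the partition relation $\Omega\longrightarrow(\mathcal{O}_n)^2_k$ says that for each $\mathcal{U}\in\Omega$ and each function $f:[\mathcal{U}]^2\to\{1,\dots,k\}$ there are an $i\in\{1,\dots,k\}$ and a $\mathcal{V}\subseteq\mathcal{U}$ such that $\mathcal{V}\in\mathcal{O}_n$ and $f$ is constant of value $i$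 on $[\mathcal{V}]^2$. Theorem. For a topological space $X$ and a positive integer $n$, the following are equivalent: 1. For each positive integer $k$, $\Omega\longrightarrow(\mathcal{O}_n)^2_k$ holds for $X$. 2. The $n$-th power $X^n$, with the Tychonoff product topology, has the property $\mathsf{S}_1(\mathcal{O},\mathcal{O})$. -/

import Mathlib

/-- The selection principle `S₁(𝒜, ℬ)`: for each sequence `(Oₙ)` of elements of `𝒜` there is a
sequence `(Tₙ)` with `Tₙ ∈ Oₙ` for all `n` and `{Tₙ : n ∈ ℕ} ∈ ℬ`. -/
def SelectionOne {α : Type*} (𝒜 ℬ : Set (Set α)) : Prop :=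
  ∀ O : ℕ → Set α, (∀ n, O n ∈ 𝒜) →
    ∃ T : ℕ → α, (∀ n, T n ∈ O n) ∧ Set.range T ∈ ℬ

/-- `[S]^m`, the set of all `m`-element subsets of `S`. -/
def subsetsOfSize {α : Type*} (S : Set α) (m : ℕ) : Set (Finset α) :=
  {s | (s : Set α) ⊆ S ∧ s.card = m}

/-- The partition relation `𝒜 ⟶ (ℬ)^m_k`: for each `A ∈ 𝒜` and each colouring `f` of `[A]^m` with
`k` colours there are a colour `i` and a `B ⊆ A` with `B ∈ ℬ` such that `f` is constant of
value `i` on `[B]^m`. -/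
def PartitionRelation {α : Type*} (𝒜 ℬ : Set (Set α)) (m k : ℕ) : Prop :=
  ∀ A ∈ 𝒜, ∀ f : subsetsOfSize A m → Fin k,
    ∃ i : Fin k, ∃ B : Set α, B ⊆ A ∧ B ∈ ℬ ∧
      ∀ s : subsetsOfSize A m, (s : Finset α) ∈ subsetsOfSize B m → f s = i

/-- `𝒪`, the collection of all open covers of the space `X`. -/
def openCovers (X : Type*) [TopologicalSpace X] : Set (Set (Set X)) :=
  {𝒰 | (∀ U ∈ 𝒰, IsOpen U) ∧ ⋃₀ 𝒰 = Set.univ}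

/-- `Ω`, the collection of all (open) `ω`-covers of the space `X`: open covers that do not have
`X` itself as a member and in which each finite subset of `X` is contained in a member. -/
def omegaCovers (X : Type*) [TopologicalSpace X] : Set (Set (Set X)) :=
  {𝒰 | 𝒰 ∈ openCovers X ∧ Set.univ ∉ 𝒰 ∧ ∀ F : Finset X, ∃ U ∈ 𝒰, (F : Set X) ⊆ U}

/-- `𝒪ₙ`, the collection of the open covers of `X` in which each subset of `X` with at most `n`
elements is contained in a member. -/
def openCoversOfSize (X : Type*) [TopologicalSpace X] (n : ℕ) : Set (Set (Set X)) :=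
  {𝒰 | 𝒰 ∈ openCovers X ∧ ∀ F : Finset X, F.card ≤ n → ∃ U ∈ 𝒰, (F : Set X) ⊆ U}

/-- The Rothberger covering property `S₁(𝒪, 𝒪)`. -/
def IsRothberger (X : Type*) [TopologicalSpace X] : Prop :=
  SelectionOne (openCovers X) (openCovers X)

open Set

/-! From 2 to 1: put an ultrafilter `p` on the `ω`-cover, concentrated on members containing any
given finite set. Each member `U` has one colour with `p`-almost all others, and `p`-almost all `U`
share that colour `i`. So a homogeneous choice of colour `i` can always be prolonged by members
whose `n`-th powers cover `Xⁿ`. This is a strategy in the Rothberger game on `Xⁿ`, and Pawlikowski's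
theorem (`IsRothberger.exists_play_covering`) provides a covering play against it. From 1 to 2: two
colours suffice. Colouring pairs by whether they come from the same cover of a sequence forces a
selection; covers of `Xⁿ` are pulled back to `ω`-covers of `X`. -/

/-- The list of the first `n` values of `f`, the latest one first. -/
def initialPlay {α : Type*} (f : ℕ → α) : ℕ → List α
  | 0 => []
  | n + 1 => f n :: initialPlay f n

theorem mem_initialPlay {α : Type*} (f : ℕ → α) (n : ℕ) (a : α) :
    a ∈ initialPlay f n ↔ ∃ i < n, f i = a := by
  induction n with
  | zero => simp [initialPlay]
  | succ n ih =>
    simp only [initialPlay, List.mem_cons, ih]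
    constructor
    · rintro (rfl | ⟨i, hi, rfl⟩)
      · exact ⟨n, by omega, rfl⟩
      · exact ⟨i, by omega, rfl⟩
    · rintro ⟨i, hi, rfl⟩
      rcases Nat.lt_succ_iff_lt_or_eq.1 hi with h | rfl
      · exact Or.inr ⟨i, h, rfl⟩
      · exact Or.inl rfl

theorem length_initialPlay {α : Type*} (f : ℕ → α) (n : ℕ) : (initialPlay f n).length = n := by
  induction n with
  | zero => rfl
  | succ n ih => simp [initialPlay, ih]

/-- The sequence of moves determined by responses `g n` to the list of the first `n` moves. -/
theorem exists_play {α : Type*} (g : ℕ → List α → α) :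
    ∃ f : ℕ → α, ∀ n, f n = g n (initialPlay f n) := by
  let L : ℕ → List α := fun n => Nat.rec [] (fun m l => g m l :: l) n
  refine ⟨fun n => g n (L n), fun n => ?_⟩
  have h : ∀ n, initialPlay (fun n => g n (L n)) n = L n := by
    intro n
    induction n with
    | zero => rfl
    | succ n ih => simp [initialPlay, ih, L]
  rw [h]

/-! ### Selections and the game in Rothberger spaces -/

/-- Selecting from indexed open covers in a Rothberger space. -/
theorem IsRothberger.exists_selection {Y : Type*} [TopologicalSpace Y] (hY : IsRothberger Y)
    {ι : Type*} (I : ℕ → Set ι) (O : ℕ → ι → Set Y) (hO : ∀ n, ∀ i ∈ I n, IsOpen (O n i))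
    (hc : ∀ n y, ∃ i ∈ I n, y ∈ O n i) :
    ∃ t : ℕ → ι, (∀ n, t n ∈ I n) ∧ ∀ y, ∃ n, y ∈ O n (t n) := by
  obtain ⟨T, hT, hR⟩ := hY (fun n => O n '' I n) (fun n => ⟨by
    rintro _ ⟨i, hi, rfl⟩
    exact hO n i hi, eq_univ_of_forall fun y => by
      obtain ⟨i, hi, hy⟩ := hc n y
      exact ⟨_, ⟨i, hi, rfl⟩, hy⟩⟩)
  choose t ht hOt using hT
  refine ⟨t, ht, fun y => ?_⟩
  have hy : y ∈ ⋃₀ range T := hR.2 ▸ mem_univ y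
  obtain ⟨_, ⟨n, rfl⟩, hy⟩ := hy
  exact ⟨n, hOt n ▸ hy⟩

/-- In a Rothberger space, for increasing countable open covers one per index `m`, some monotone
choice of members catches each point infinitely often. -/
theorem IsRothberger.exists_frequently_mem {Y : Type*} [TopologicalSpace Y] (hY : IsRothberger Y)
    (D : ℕ → ℕ → Set Y) (hD : ∀ m k, IsOpen (D m k)) (hc : ∀ m y, ∃ k, y ∈ D m k)
    (hmono : ∀ m, Monotone (D m)) :
    ∃ h : ℕ → ℕ, Monotone h ∧ (∀ m, m < h m) ∧ ∀ y a, ∃ m, a ≤ m ∧ y ∈ D m (h m) := by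
  have key : ∀ a, ∃ t : ℕ → ℕ, ∀ y, ∃ m, y ∈ D (a + m) (t m) := fun a => by
    obtain ⟨t, -, ht⟩ := hY.exists_selection (fun _ => univ) (fun m => D (a + m))
      (fun m k _ => hD _ k) (fun m y => by simpa using hc (a + m) y)
    exact ⟨t, ht⟩
  choose t ht using key
  -- `t a` selects from the tail starting at `a`; the sum makes `h` monotone and bounds all `t a b`
  -- with `a, b ≤ m`.
  let h : ℕ → ℕ := fun m =>
    m + 1 + ∑ a ∈ Finset.range (m + 1), ∑ b ∈ Finset.range (m + 1), t a b
  refine ⟨h, fun m m' hm => ?_, fun m => by simp only [h]; omega, fun y a => ?_⟩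
  · have hs : Finset.range (m + 1) ⊆ Finset.range (m' + 1) := Finset.range_mono (by omega)
    have : ∑ a ∈ Finset.range (m + 1), ∑ b ∈ Finset.range (m + 1), t a b ≤
        ∑ a ∈ Finset.range (m' + 1), ∑ b ∈ Finset.range (m' + 1), t a b :=
      (Finset.sum_le_sum fun a _ => Finset.sum_le_sum_of_subset hs).trans
        (Finset.sum_le_sum_of_subset hs)
    simp only [h]
    omega
  · obtain ⟨m, hm⟩ := ht a y
    refine ⟨a + m, by omega, hmono _ ?_ hm⟩
    have h1 : t a m ≤ ∑ b ∈ Finset.range (a + m + 1), t a b :=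
      Finset.single_le_sum (f := fun b => t a b) (fun _ _ => Nat.zero_le _)
        (Finset.mem_range.2 (by omega))
    have h2 : ∑ b ∈ Finset.range (a + m + 1), t a b ≤
        ∑ a' ∈ Finset.range (a + m + 1), ∑ b ∈ Finset.range (a + m + 1), t a' b :=
      Finset.single_le_sum (f := fun a' => ∑ b ∈ Finset.range (a + m + 1), t a' b)
        (fun _ _ => Nat.zero_le _) (Finset.mem_range.2 (by omega))
    simp only [h]
    omega

/-- Finite sets `F j` with `j + 1` elements have distinct representatives. -/
theorem exists_injective_mem_of_card (F : ℕ → Finset ℕ) (hF : ∀ j, (F j).card = j + 1) :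
    ∃ ν : ℕ → ℕ, Function.Injective ν ∧ ∀ j, ν j ∈ F j := by
  refine (Finset.all_card_le_biUnion_card_iff_exists_injective F).1 fun s => ?_
  rcases s.eq_empty_or_nonempty with rfl | hs
  · simp
  · have h1 : s ⊆ Finset.range (s.max' hs + 1) := fun j hj =>
      Finset.mem_range.2 (Nat.lt_succ_of_le (s.le_max' j hj))
    calc s.card ≤ s.max' hs + 1 := by simpa using Finset.card_le_card h1
      _ = (F (s.max' hs)).card := (hF _).symm
      _ ≤ _ := Finset.card_le_card (Finset.subset_biUnion_of_mem F (s.max'_mem hs))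

/-- The lists of length at most `m` with entries below `m`. -/
def boundedLists (m : ℕ) : Set (List ℕ) :=
  {l | l.length ≤ m ∧ ∀ i ∈ l, i < m}

theorem finite_boundedLists (m : ℕ) : (boundedLists m).Finite := by
  refine ((List.finite_length_le (Fin m) m).image (List.map Fin.val)).subset ?_
  rintro l ⟨hl, hm⟩
  exact ⟨l.pmap Fin.mk hm, by simpa using hl, by simp [List.map_pmap]⟩

theorem boundedLists_mono : Monotone boundedLists := fun _ _ h _ hl =>
  ⟨hl.1.trans h, fun i hi => (hl.2 i hi).trans_le h⟩

/-- A tree of countable open covers of a Rothberger space has a branch that covers. -/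
theorem IsRothberger.exists_branch {Y : Type*} [TopologicalSpace Y] (hY : IsRothberger Y)
    (N : List ℕ → ℕ → Set Y) (hN : ∀ l k, IsOpen (N l k)) (hc : ∀ l y, ∃ k, y ∈ N l k) :
    ∃ f : ℕ → ℕ, ∀ y, ∃ n, y ∈ N (initialPlay f n) (f n) := by
  classical
  -- `C m k`: points caught by a move below `k` at every position in `boundedLists m`.
  let C : ℕ → ℕ → Set Y := fun m k => ⋂ l ∈ boundedLists m, ⋃ i ∈ Iio k, N l i
  have memC : ∀ {m k y}, y ∈ C m k ↔ ∀ l ∈ boundedLists m, ∃ i < k, y ∈ N l i := by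
    intro m k y
    simp [C]
  have hC : ∀ m k, IsOpen (C m k) := fun m k =>
    (finite_boundedLists m).isOpen_biInter fun l _ => isOpen_biUnion fun i _ => hN l i
  have Cmono : ∀ {m m' k k' y}, m' ≤ m → k ≤ k' → y ∈ C m k → y ∈ C m' k' := by
    intro m m' k k' y hm hk hy
    rw [memC] at hy ⊢
    intro l hl
    obtain ⟨i, hi, h⟩ := hy l (boundedLists_mono hm hl)
    exact ⟨i, hi.trans_le hk, h⟩
  have Ccov : ∀ m y, ∃ k, y ∈ C m k := by
    intro m y
    choose κ hκ using fun l => hc l y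
    obtain ⟨b, hb⟩ := ((finite_boundedLists m).image κ).bddAbove
    exact ⟨b + 1, memC.2 fun l hl => ⟨κ l, Nat.lt_succ_of_le (hb ⟨l, hl, rfl⟩), hκ l⟩⟩
  -- The intermediate `j` pays for not knowing where `m` lies in its block `[M n, M (n + 1))`:
  -- comparing `j` with `M (n + 1)` shows that block `n` or block `n + 1` is good for `y`.
  obtain ⟨h, hmono, hlt, hfreq⟩ := hY.exists_frequently_mem
    (fun m k => ⋃ j, C m j ∩ C j k)
    (fun m k => isOpen_iUnion fun j => (hC m j).inter (hC j k))
    (fun m y => by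
      obtain ⟨j, hj⟩ := Ccov m y
      obtain ⟨k, hk⟩ := Ccov j y
      exact ⟨k, mem_iUnion.2 ⟨j, hj, hk⟩⟩)
    (fun m k k' hk => iUnion_mono fun j => inter_subset_inter_right _ fun y => Cmono le_rfl hk)
  let M : ℕ → ℕ := fun n => h^[n] 0
  have Msucc : ∀ n, M (n + 1) = h (M n) := fun n => Function.iterate_succ_apply' h n 0
  have Mlt : StrictMono M := strictMono_nat_of_lt_succ fun n => by
    rw [Msucc]
    exact hlt _
  have good : ∀ y a, ∃ n, a ≤ n ∧ y ∈ C (M n) (M (n + 1)) := by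
    intro y a
    obtain ⟨m, ham, hm⟩ := hfreq y (M a)
    obtain ⟨j, hj, hjm⟩ := mem_iUnion.1 hm
    have hex : ∃ n, m < M (n + 1) := ⟨m, Nat.lt_of_lt_of_le (Nat.lt_succ_self m) (Mlt.le_apply)⟩
    let n := Nat.find hex
    have hn : m < M (n + 1) := Nat.find_spec hex
    have hn' : M n ≤ m := by
      rcases Nat.eq_zero_or_pos n with h0 | h0
      · rw [h0]
        exact Nat.zero_le _
      · have := Nat.find_min hex (m := n - 1) (Nat.sub_lt h0 one_pos)
        rw [show n - 1 + 1 = n by omega] at this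
        exact not_lt.1 this
    have han : a ≤ n := Nat.lt_succ_iff.1 (Mlt.lt_iff_lt.1 (ham.trans_lt hn))
    rcases le_total j (M (n + 1)) with hjn | hjn
    · exact ⟨n, han, Cmono hn' hjn hj⟩
    · refine ⟨n + 1, by omega, Cmono hjn ?_ hjm⟩
      rw [Msucc (n + 1)]
      exact hmono hn.le
  let W : ℕ → (List ℕ → ℕ) → Set Y := fun n s => ⋂ l ∈ boundedLists (M n), N l (s l)
  have hW : ∀ n s, IsOpen (W n s) := fun n s =>
    (finite_boundedLists _).isOpen_biInter fun l _ => hN l _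
  have Mpos : ∀ n, 0 < M (n + 1) := fun n => (Nat.zero_le _).trans_lt (Mlt (Nat.lt_succ_self n))
  have Wcov : ∀ n y, y ∈ C (M n) (M (n + 1)) →
      ∃ s : List ℕ → ℕ, (∀ l, s l < M (n + 1)) ∧ y ∈ W n s := by
    intro n y hy
    have : ∀ l, ∃ i < M (n + 1), l ∈ boundedLists (M n) → y ∈ N l i := fun l => by
      by_cases hl : l ∈ boundedLists (M n)
      · obtain ⟨i, hi, h⟩ := memC.1 hy l hl
        exact ⟨i, hi, fun _ => h⟩
      · exact ⟨0, Mpos n, fun h => absurd h hl⟩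
    choose s hs hsy using this
    exact ⟨s, hs, mem_iInter₂.2 hsy⟩
  -- The `j`-th selection answers on `j + 1` blocks at once, so that distinct selections can be
  -- given distinct blocks `ν j` and their answers never conflict.
  obtain ⟨t, ht, htc⟩ := hY.exists_selection
    (ι := Finset ℕ × (ℕ → List ℕ → ℕ))
    (fun j => {p | p.1.card = j + 1 ∧ ∀ n l, p.2 n l < M (n + 1)})
    (fun _ p => ⋂ n ∈ p.1, W n (p.2 n))
    (fun j p _ => isOpen_biInter_finset fun n _ => hW n _)
    (fun j y => by
      have hinf : {n | y ∈ C (M n) (M (n + 1))}.Infinite := by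
        refine Set.infinite_of_not_bddAbove ?_
        rintro ⟨b, hb⟩
        obtain ⟨n, hn, hy⟩ := good y (b + 1)
        have := hb hy
        omega
      obtain ⟨F, hF, hcard⟩ := hinf.exists_subset_card_eq (j + 1)
      have : ∀ n, ∃ s : List ℕ → ℕ, (∀ l, s l < M (n + 1)) ∧ (n ∈ F → y ∈ W n s) := fun n => by
        by_cases hn : n ∈ F
        · obtain ⟨s, hs, h⟩ := Wcov n y (hF hn)
          exact ⟨s, hs, fun _ => h⟩
        · exact ⟨fun _ => 0, fun _ => Mpos n, fun h => absurd h hn⟩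
      choose s hs hsy using this
      exact ⟨(F, s), ⟨hcard, hs⟩, mem_iInter₂.2 hsy⟩)
  obtain ⟨ν, hν, hνF⟩ := exists_injective_mem_of_card (fun j => (t j).1) fun j => (ht j).1
  have hS : ∀ n, ∃ s : List ℕ → ℕ, (∀ l, s l < M (n + 1)) ∧ ∀ j, ν j = n → s = (t j).2 n := by
    intro n
    by_cases hn : ∃ j, ν j = n
    · obtain ⟨j, hj⟩ := hn
      exact ⟨(t j).2 n, (ht j).2 n, fun j' hj' => by rw [hν (hj.trans hj'.symm)]⟩
    · exact ⟨fun _ => 0, fun _ => Mpos n, fun j hj => absurd ⟨j, hj⟩ hn⟩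
  choose s hs hst using hS
  obtain ⟨f, hf⟩ := exists_play s
  refine ⟨f, fun y => ?_⟩
  obtain ⟨j, hj⟩ := htc y
  have hyW := mem_iInter₂.1 hj (ν j) (hνF j)
  rw [← hst (ν j) j rfl] at hyW
  refine ⟨ν j, ?_⟩
  rw [hf (ν j)]
  -- The position reached lies in `boundedLists (M (ν j))`, since earlier moves satisfy `f a < M (a
  -- + 1) ≤ M (ν j)`.
  refine mem_iInter₂.1 hyW _ ⟨?_, fun i hi => ?_⟩
  · rw [length_initialPlay]
    exact Mlt.le_apply
  · obtain ⟨a, ha, rfl⟩ := (mem_initialPlay f _ i).1 hi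
    rw [hf a]
    exact (hs a _).trans_le (Mlt.monotone ha)

/-- **Pawlikowski's theorem**: in a Rothberger space, no strategy of the first player in the
Rothberger game is winning. -/
theorem IsRothberger.exists_play_covering {Y : Type*} [TopologicalSpace Y] (hY : IsRothberger Y)
    {ι : Type*} (O : ι → Set Y) (σ : List ι → Set ι) (hO : ∀ l, ∀ i ∈ σ l, IsOpen (O i))
    (hc : ∀ l y, ∃ i ∈ σ l, y ∈ O i) :
    ∃ t : ℕ → ι, (∀ n, t n ∈ σ (initialPlay t n)) ∧ ∀ y, ∃ n, y ∈ O (t n) := by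
  choose e he hec using fun l =>
    hY.exists_selection (fun _ => σ l) (fun _ => O) (fun _ => hO l) (fun _ => hc l)
  let P : List ℕ → List ι := fun l => l.rec [] fun k _ p => e p k :: p
  obtain ⟨f, hf⟩ := hY.exists_branch (fun l k => O (e (P l) k))
    (fun l k => hO _ _ (he (P l) k)) (fun l => hec (P l))
  have hP : ∀ n, initialPlay (fun n => e (P (initialPlay f n)) (f n)) n =
      P (initialPlay f n) := by
    intro n
    induction n with
    | zero => rfl
    | succ n ih => simp [initialPlay, ih, P]
  refine ⟨fun n => e (P (initialPlay f n)) (f n), fun n => ?_, hf⟩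
  rw [hP]
  exact he _ _

/-! ### Homogeneous subfamilies from an ultrafilter -/

theorem exists_fin_range_superset {X : Type*} [Nonempty X] {n : ℕ} (F : Finset X)
    (hF : F.card ≤ n) : ∃ g : Fin n → X, (F : Set X) ⊆ range g := by
  classical
  refine ⟨fun i => if h : (i : ℕ) < F.card then F.equivFin.symm ⟨i, h⟩
    else Classical.arbitrary X, fun x hx => ?_⟩
  refine ⟨⟨F.equivFin ⟨x, hx⟩, (F.equivFin ⟨x, hx⟩).2.trans_le hF⟩, ?_⟩
  simp

/-- An `ω`-cover carries an ultrafilter all of whose members are `ω`-covers. -/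
theorem exists_ultrafilter_of_omegaCover {X : Type*} (𝒰 : Set (Set X))
    (h𝒰 : ∀ F : Finset X, ∃ U ∈ 𝒰, (F : Set X) ⊆ U) :
    ∃ p : Ultrafilter (Set X), ∀ F : Finset X, ∀ᶠ U in p, U ∈ 𝒰 ∧ (F : Set X) ⊆ U := by
  classical
  let l : Filter (Set X) := ⨅ F : Finset X, Filter.principal {U | U ∈ 𝒰 ∧ (F : Set X) ⊆ U}
  have : l.NeBot := by
    refine Filter.iInf_neBot_of_directed' ?_ fun F => Filter.principal_neBot_iff.2 (h𝒰 F)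
    intro F G
    refine ⟨F ∪ G, ?_, ?_⟩ <;>
    · simp only [ge_iff_le, Filter.le_principal_iff, Filter.mem_principal]
      rintro U ⟨hU, hFG⟩
      rw [Finset.coe_union, union_subset_iff] at hFG
      exact ⟨hU, by tauto⟩
  refine ⟨Ultrafilter.of l, fun F => ?_⟩
  exact Ultrafilter.of_le l (Filter.mem_iInf_of_mem F (Filter.mem_principal_self _))

theorem Ultrafilter.exists_eventually_eq {α β : Type*} [Finite β] (p : Ultrafilter α)
    (c : α → β) : ∃ b, ∀ᶠ a in p, c a = b := by
  obtain ⟨b, hb⟩ := Ultrafilter.eq_pure_of_finite (p.map c)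
  refine ⟨b, ?_⟩
  have : {b} ∈ p.map c := hb ▸ rfl
  exact this

theorem partitionRelation_of_isRothberger {X : Type*} [TopologicalSpace X] [Nonempty X]
    {n : ℕ} (hn : 0 < n) (hX : IsRothberger (Fin n → X)) {k : ℕ} (hk : 0 < k) :
    PartitionRelation (omegaCovers X) (openCoversOfSize X n) 2 k := by
  classical
  rintro 𝒰 ⟨⟨h𝒰o, -⟩, -, h𝒰⟩ f
  obtain ⟨p, hp⟩ := exists_ultrafilter_of_omegaCover 𝒰 h𝒰
  let col : Set X → Set X → Fin k := fun U V =>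
    if h : ({U, V} : Finset (Set X)) ∈ subsetsOfSize 𝒰 2 then f ⟨_, h⟩ else ⟨0, hk⟩
  choose c hcol using fun U => p.exists_eventually_eq (col U)
  obtain ⟨i, hi⟩ := p.exists_eventually_eq c
  let σ : List (Set X) → Set (Set X) := fun l =>
    {V | V ∈ 𝒰 ∧ c V = i ∧ ∀ U ∈ l, c U = i → col U V = i}
  have hσ : ∀ l : List (Set X), ∀ᶠ V in p, ∀ U ∈ l, c U = i → col U V = i := by
    intro l
    induction l with
    | nil => simp
    | cons U l ih =>
      filter_upwards [ih, hcol U] with V hV hUV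
      intro U' hU' hc
      rcases List.mem_cons.1 hU' with rfl | h
      · exact hUV.trans hc
      · exact hV U' h hc
  obtain ⟨t, ht, htc⟩ := hX.exists_play_covering (fun U => univ.pi fun _ => U) σ
    (fun l U hU => isOpen_set_pi finite_univ fun _ _ => h𝒰o U hU.1)
    (fun l y => by
      obtain ⟨V, hV, hi, ⟨h1, h2⟩⟩ :=
        ((hσ l).and (hi.and (hp (Finset.univ.image y)))).exists
      refine ⟨V, ⟨h1, hi, hV⟩, fun j _ => h2 ?_⟩
      simp)
  have hcov : ∀ F : Finset X, F.card ≤ n → ∃ U ∈ range t, (F : Set X) ⊆ U := by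
    intro F hF
    obtain ⟨g, hg⟩ := exists_fin_range_superset F hF
    obtain ⟨m, hm⟩ := htc g
    refine ⟨t m, ⟨m, rfl⟩, hg.trans ?_⟩
    rintro _ ⟨j, rfl⟩
    exact hm j (mem_univ j)
  refine ⟨i, range t, ?_, ⟨⟨?_, ?_⟩, hcov⟩, ?_⟩
  · rintro _ ⟨m, rfl⟩
    exact (ht m).1
  · rintro _ ⟨m, rfl⟩
    exact h𝒰o _ (ht m).1
  · refine eq_univ_of_forall fun x => ?_
    obtain ⟨U, hU, hx⟩ := hcov {x} (by simpa using Nat.succ_le_of_lt hn)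
    exact ⟨U, hU, hx (by simp)⟩
  · have key : ∀ a b, a < b → ∀ s : subsetsOfSize 𝒰 2,
        (s : Finset (Set X)) = {t a, t b} → f s = i := by
      rintro a b hab ⟨s, hs⟩ rfl
      have := (ht b).2.2 (t a) ((mem_initialPlay t b _).2 ⟨a, hab, rfl⟩) (ht a).2.1
      simpa only [col, dif_pos hs] using this
    rintro s ⟨hs, hcard⟩
    obtain ⟨U, V, hUV, hsUV⟩ := Finset.card_eq_two.1 hcard
    obtain ⟨a, rfl⟩ := hs (show U ∈ (s : Finset (Set X)) by simp [hsUV])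
    obtain ⟨b, rfl⟩ := hs (show V ∈ (s : Finset (Set X)) by simp [hsUV])
    rcases lt_trichotomy a b with h | rfl | h
    · exact key a b h s hsUV
    · exact absurd rfl hUV
    · exact key b a h s (hsUV.trans (Finset.pair_comm _ _))

/-! ### From two colours to the Rothberger property -/

/-- The partition relation for two colours gives the selection principle `S₁(Ω, 𝒪ₙ)`. -/
theorem exists_selection_of_partitionRelation {X : Type*} [TopologicalSpace X] [T1Space X]
    [Infinite X] {n : ℕ} (h : PartitionRelation (omegaCovers X) (openCoversOfSize X n) 2 2)
    (𝒲 : ℕ → Set (Set X)) (ho : ∀ m, ∀ W ∈ 𝒲 m, IsOpen W)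
    (hω : ∀ m, ∀ F : Finset X, ∃ W ∈ 𝒲 m, (F : Set X) ⊆ W) :
    ∃ T : ℕ → Set X, (∀ m, T m ∈ 𝒲 m) ∧
      ∀ F : Finset X, F.card ≤ n → ∃ m, (F : Set X) ⊆ T m := by
  classical
  let x : ℕ ↪ X := Infinite.natEmbedding X
  -- Deleting `x m` keeps `X` out of `𝒱` and prevents sets with the same index `m` from covering
  -- `X`; hence on `B` distinct sets have distinct indices.
  let 𝒱 : Set (Set X) := {V | ∃ m, ∃ W ∈ 𝒲 m, V = W \ {x m}}
  have hr : ∀ V, ∃ m, V ∈ 𝒱 → ∃ W ∈ 𝒲 m, V = W \ {x m} := fun V => by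
    by_cases hV : V ∈ 𝒱
    · obtain ⟨m, hm⟩ := hV
      exact ⟨m, fun _ => hm⟩
    · exact ⟨0, fun h => absurd h hV⟩
  choose r hr using hr
  have hV𝒱 : ∀ F : Finset X, ∃ V ∈ 𝒱, (F : Set X) ⊆ V := fun F => by
    obtain ⟨m, hm⟩ : ∃ m, x m ∉ F := by
      by_contra hcon
      push Not at hcon
      exact (infinite_range_of_injective x.injective)
        (F.finite_toSet.subset (range_subset_iff.2 hcon))
    obtain ⟨W, hW, hFW⟩ := hω m F
    exact ⟨_, ⟨m, W, hW, rfl⟩, subset_sdiff_singleton hFW hm⟩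
  have h𝒱 : 𝒱 ∈ omegaCovers X := by
    refine ⟨⟨?_, ?_⟩, ?_, hV𝒱⟩
    · rintro _ ⟨m, W, hW, rfl⟩
      exact (ho m W hW).sdiff isClosed_singleton
    · refine eq_univ_of_forall fun y => ?_
      obtain ⟨V, hV, hy⟩ := hV𝒱 {y}
      exact ⟨V, hV, hy (by simp)⟩
    · rintro ⟨m, W, -, hW⟩
      exact (hW ▸ mem_univ (x m) : x m ∈ W \ {x m}).2 rfl
  obtain ⟨i, B, hB𝒱, ⟨⟨-, hBc⟩, hBn⟩, hBi⟩ := h 𝒱 h𝒱 fun s =>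
    if ∀ U ∈ (s : Finset (Set X)), ∀ V ∈ (s : Finset (Set X)), r U = r V then 0 else 1
  have hpair : ∀ U ∈ B, ∀ V ∈ B, U ≠ V → (if r U = r V then (0 : Fin 2) else 1) = i := by
    intro U hU V hV hUV
    have hsub : ∀ A : Set (Set X), U ∈ A → V ∈ A →
        ({U, V} : Finset (Set X)) ∈ subsetsOfSize A 2 := fun A hU hV =>
      ⟨by simp [insert_subset_iff, hU, hV], Finset.card_pair hUV⟩
    rw [← hBi ⟨{U, V}, hsub 𝒱 (hB𝒱 hU) (hB𝒱 hV)⟩ (hsub B hU hV)]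
    refine if_congr ?_ rfl rfl
    simp only [Finset.mem_insert, Finset.mem_singleton, forall_eq_or_imp, forall_eq]
    tauto
  have hinj : ∀ U ∈ B, ∀ V ∈ B, r U = r V → U = V := by
    intro U hU V hV hUV
    by_contra hne
    have hi := hpair U hU V hV hne
    rw [if_pos hUV] at hi
    have hconst : ∀ V ∈ B, r U = r V := fun V hV => by
      by_contra hr
      have := hpair U hU V hV fun h => hr (h ▸ rfl)
      rw [if_neg hr, ← hi] at this
      exact absurd this (by decide)
    have hx : x (r U) ∈ ⋃₀ B := hBc ▸ mem_univ _
    obtain ⟨V, hV, hx⟩ := hx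
    obtain ⟨W, -, hW⟩ := hr V (hB𝒱 hV)
    rw [hW, ← hconst V hV] at hx
    exact hx.2 rfl
  have hT : ∀ m, ∃ T ∈ 𝒲 m, ∀ V ∈ B, r V = m → V ⊆ T := by
    intro m
    by_cases hm : ∃ V ∈ B, r V = m
    · obtain ⟨V, hV, rfl⟩ := hm
      obtain ⟨W, hW, hVW⟩ := hr V (hB𝒱 hV)
      refine ⟨W, hW, fun V' hV' hr' => ?_⟩
      rw [hinj V' hV' V hV hr', hVW]
      exact sdiff_subset
    · obtain ⟨W, hW, -⟩ := hω m ∅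
      exact ⟨W, hW, fun V hV hr => absurd ⟨V, hV, hr⟩ hm⟩
  choose T hT hTV using hT
  refine ⟨T, hT, fun F hF => ?_⟩
  obtain ⟨V, hV, hFV⟩ := hBn F hF
  exact ⟨r V, hFV.trans (hTV _ V hV rfl)⟩

/-- An open set of `Xⁿ` that contains `Fⁿ` for a finite `F` contains `Wⁿ` for an open `W ⊇ F`. -/
theorem exists_isOpen_pi_subset {X κ : Type*} [TopologicalSpace X] [Finite κ] (F : Finset X)
    {G : Set (κ → X)} (hG : IsOpen G) (hF : (univ.pi fun _ => (F : Set X)) ⊆ G) :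
    ∃ W : Set X, IsOpen W ∧ (F : Set X) ⊆ W ∧ (univ.pi fun _ => W) ⊆ G := by
  have : ∀ q : κ → F, ∃ u : κ → Set X, (∀ a, IsOpen (u a) ∧ (q a : X) ∈ u a) ∧ univ.pi u ⊆ G :=
    fun q => isOpen_pi_iff'.1 hG (fun a => q a) (hF fun a _ => (q a).2)
  choose u hu huG using this
  refine ⟨⋃ z : F, ⋂ q : κ → F, ⋂ a : κ, ⋂ _ : q a = z, u q a, ?_, ?_, ?_⟩
  · exact isOpen_iUnion fun z => isOpen_iInter_of_finite fun q => isOpen_iInter_of_finite fun a =>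
      isOpen_iInter_of_finite fun _ => (hu q a).1
  · intro z hz
    simp only [mem_iUnion, mem_iInter]
    refine ⟨⟨z, hz⟩, fun q a hq => ?_⟩
    have := (hu q a).2
    rwa [hq] at this
  · intro w hw
    have hw' : ∀ a, ∃ z : F, ∀ q : κ → F, ∀ b, q b = z → w a ∈ u q b := fun a => by
      simpa only [mem_iUnion, mem_iInter] using hw a (mem_univ a)
    choose z hz using hw'
    exact huG z fun a _ => hz a z a rfl

/-- Serves for finite `X`, where the deletion of infinitely many distinct points is impossible. -/
theorem isRothberger_of_countable (Y : Type*) [TopologicalSpace Y] [Countable Y] [Nonempty Y] :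
    IsRothberger Y := by
  intro O hO
  obtain ⟨y, hy⟩ := exists_surjective_nat Y
  have : ∀ m, ∃ U ∈ O m, y m ∈ U := fun m => by
    have : y m ∈ ⋃₀ O m := (hO m).2 ▸ mem_univ _
    exact this
  choose T hT hyT using this
  refine ⟨T, hT, ?_, eq_univ_of_forall fun z => ?_⟩
  · rintro _ ⟨m, rfl⟩
    exact (hO m).1 _ (hT m)
  · obtain ⟨m, rfl⟩ := hy z
    exact ⟨T m, ⟨m, rfl⟩, hyT m⟩

theorem isRothberger_pi_of_selection {X : Type*} [TopologicalSpace X] [Nonempty X] {n : ℕ}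
    (h : ∀ 𝒲 : ℕ → Set (Set X), (∀ m, ∀ W ∈ 𝒲 m, IsOpen W) →
      (∀ m, ∀ F : Finset X, ∃ W ∈ 𝒲 m, (F : Set X) ⊆ W) →
      ∃ T : ℕ → Set X, (∀ m, T m ∈ 𝒲 m) ∧
        ∀ F : Finset X, F.card ≤ n → ∃ m, (F : Set X) ⊆ T m) :
    IsRothberger (Fin n → X) := by
  classical
  intro G hG
  have hmem : ∀ m y, ∃ U ∈ G m, y ∈ U := fun m y => by
    have : y ∈ ⋃₀ G m := (hG m).2 ▸ mem_univ y
    exact this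
  -- Pairing splits the covers into infinitely many rows. Row `m` yields the `W` whose power is
  -- covered by one pick per cover of that row; since `Fⁿ` is finite, these form an `ω`-cover up to
  -- the possible member `X`.
  obtain ⟨T, hT, hTc⟩ := h
    (fun m => {W | IsOpen W ∧ ∃ U : ℕ → Set (Fin n → X), (∀ j, U j ∈ G (Nat.pair m j)) ∧
      (univ.pi fun _ => W) ⊆ ⋃ j, U j})
    (fun m W hW => hW.1)
    (fun m F => by
      have hfin : (univ.pi fun _ : Fin n => (F : Set X)).Finite :=
        Set.Finite.pi fun _ => F.finite_toSet
      obtain ⟨y, hy⟩ := countable_iff_exists_subset_range.1 hfin.countable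
      choose U hU hyU using fun j => hmem (Nat.pair m j) (y j)
      obtain ⟨W, hWo, hFW, hW⟩ := exists_isOpen_pi_subset F
        (isOpen_iUnion fun j => (hG _).1 _ (hU j))
        (hy.trans (range_subset_iff.2 fun j => mem_iUnion.2 ⟨j, hyU j⟩))
      exact ⟨W, ⟨hWo, U, hU, hW⟩, hFW⟩)
  choose U hU hTU using fun m => (hT m).2
  have hmemU : ∀ q : ℕ, U q.unpair.1 q.unpair.2 ∈ G q := fun q => by
    simpa only [Nat.pair_unpair] using hU q.unpair.1 q.unpair.2
  refine ⟨fun q => U q.unpair.1 q.unpair.2, hmemU, ?_, eq_univ_of_forall fun y => ?_⟩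
  · rintro _ ⟨q, rfl⟩
    exact (hG q).1 _ (hmemU q)
  · obtain ⟨m, hm⟩ := hTc (Finset.univ.image y) (Finset.card_image_le.trans (by simp))
    obtain ⟨j, hj⟩ := mem_iUnion.1 (hTU m fun i _ => hm (by simp) : y ∈ ⋃ j, U m j)
    exact ⟨_, ⟨Nat.pair m j, rfl⟩, by simpa only [Nat.unpair_pair] using hj⟩

theorem mainTheorem9 (X : Type*) [TopologicalSpace X] [T2Space X] [Nonempty X]
    (n : ℕ) (hn : 0 < n) :
    (∀ k : ℕ, 0 < k → PartitionRelation (omegaCovers X) (openCoversOfSize X n) 2 k) ↔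
      IsRothberger (Fin n → X) := by
  refine ⟨fun h => ?_, fun h k hk => partitionRelation_of_isRothberger hn h hk⟩
  rcases finite_or_infinite X with hX | hX
  · exact isRothberger_of_countable _
  · exact isRothberger_pi_of_selection (exists_selection_of_partitionRelation (h 2 two_pos))
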